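/- **Theorem 4.6 (Existence of Global Metric).** Let $\mathcal G=(\mathcal V,\mathcal E)$ be a simple graph on $\mathcal V=\{1,\dots,N\}$ and let $M\ge 0$. For each $i$ let $U_i\subseteq\mathbb R^M$ be a set contained in the closure of its interior (an open set together with some or all of its boundary), and let $\boldsymbol G_i$ be a continuous local metric on $U_i$, i.e. a continuous map from $U_i$ to the symmetric positive definite $M\times M$ matrices, with $\boldsymbol G_i(x)(u,v)=u^\top \boldsymbol G_i(x)v$ for $u,v\in T_xU_i=\mathbb R^M$. For every edge $(i,j)\in\mathcal E$ (in both orientations) let $B_{ij}\subseteq U_i\cap\partial U_i$ be a relatively closed subset of $U_i$ (for instance all of $U_i\cap\partial U_i$), and let $\phi^{(i,j)}:B_{ij}\to B_{ji}$ be a bijection with inverse $\phi^{(j,i)}$ whose differential along $B_{ij}$ is given by the edge tangent translation: for each $x\in B_{ij}$, with $y=\phi^{(i,j)}(x)$ and $$\boldsymbol P^{(i,j)}_x=\boldsymbol G_j(y)^{-1/2}\left(\boldsymbol G_j(y)^{1/2}\,\boldsymbol G_i(x)\,\boldsymbol G_j(y)^{1/2}\right)^{1/2}\boldsymbol G_j(y)^{-1/2}:\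 T_xU_i\to T_yU_j,$$ one has $\phi^{(i,j)}(x')=\phi^{(i,j)}(x)+\boldsymbol P^{(i,j)}_x(x'-x)+o(\|x'-x\|)$ as $x'\to x$ in $B_{ij}$. Let $\mathcal F=(\bigcup_\phi)_{i=1}^N U_i$ be the glued space: the quotient of $\bigsqcup_i U_i$ by the equivalence relation generated by $x\sim\phi^{(i,j)}(x)$ for $(i,j)\in\mathcal E$, $x\in B_{ij}$, with the quotient topology. Let $T^2\mathcal F\to\mathcal F$ be its bundle of pairs of tangent vectors: the quotient of $\bigsqcup_i U_i\times\mathbb R^M\times\mathbb R^M$ by the equivalence relation generated by $(x,u,v)\sim(\phi^{(i,j)}(x),\boldsymbol P^{(i,j)}_xu,\boldsymbol P^{(i,j)}_xv)$, with the quotient topology. A continuous metric on $\mathcal F$ assigns to each $p\in\mathcal F$ a real function $\boldsymbol G_p$ on the fibre of $T^2\mathcal F$ over $p$, such that the resulting function $T^2\mathcal F\to\mathbb R$ is continuous and, for all $i$ and $x\in U_i$, its restriction $(\boldsymbol G|_{U_i})_x(u,v):=\boldsymbol G_{[x]}([x,u,v])$ is a symmetric positive definite bilinear form on $T_xU_i$.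 Then there is exactly one continuous metric $\boldsymbol G$ on $\mathcal F$ such that $\boldsymbol G|_{U_i}=\boldsymbol G_i$ for all $i=1,\dots,N$. -/

import Mathlib

open scoped Matrix

noncomputable section

namespace NeuralGluing

/-- Coordinate space `ℝ^M` with the Euclidean topology; the pieces are domains in it, and it is
also the tangent space at each of their points. -/
abbrev Coord (M : ℕ) : Type := EuclideanSpace ℝ (Fin M)

/-- The bilinear form `uᵀ A v`. -/
def form {M : ℕ} (A : Matrix (Fin M) (Fin M) ℝ) (u v : Coord M) : ℝ :=
  u.ofLp ⬝ᵥ (A *ᵥ v.ofLp)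

/-- The principal square root `A^{1/2}` of a symmetric positive semidefinite matrix
(the function `√` applied to the eigenvalues). -/
def msqrt {M : ℕ} (A : Matrix (Fin M) (Fin M) ℝ) : Matrix (Fin M) (Fin M) ℝ :=
  cfc Real.sqrt A

/-- The edge tangent translation
`Gⱼ^{-1/2} (Gⱼ^{1/2} Gᵢ Gⱼ^{1/2})^{1/2} Gⱼ^{-1/2}` from a tangent space with metric `Gᵢ` to
a tangent space with metric `Gⱼ`. -/
def edgeTranslation {M : ℕ} (Gi Gj : Matrix (Fin M) (Fin M) ℝ) : Matrix (Fin M) (Fin M) ℝ :=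
  (msqrt Gj)⁻¹ * msqrt (msqrt Gj * Gi * msqrt Gj) * (msqrt Gj)⁻¹

/-- Local pieces indexed by the vertices of a graph, with local metrics and with gluing maps
along the edges.  The piece `U i` is a domain in `ℝ^M` together with (part of) its boundary.
For every edge `(i, j)` a relatively closed part `bd i j` of the boundary of `U i`
(possibly all of it) is identified with `bd j i` by `φ i j`, with inverse `φ j i`,
and the differential of `φ i j` along `bd i j` is the edge tangent translation. Values of
`G i` outside `U i`, of `φ i j` outside `bd i j`, and of `bd`, `φ` at non-edges play no role. -/
structure GluingData {N : ℕ} (𝒢 : SimpleGraph (Fin N)) (M : ℕ) where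
  /-- the local pieces -/
  U : Fin N → Set (Coord M)
  /-- a piece is an open set together with boundary points of that open set -/
  U_domain : ∀ i, U i ⊆ closure (interior (U i))
  /-- the matrices of the local metrics -/
  G : Fin N → Coord M → Matrix (Fin M) (Fin M) ℝ
  G_posDef : ∀ i, ∀ x ∈ U i, (G i x).PosDef
  G_continuousOn : ∀ i, ContinuousOn (G i) (U i)
  /-- the part of the boundary of `U i` that is glued to `U j` -/
  bd : Fin N → Fin N → Set (Coord M)
  bd_subset : ∀ i j, 𝒢.Adj i j → bd i j ⊆ U i ∩ frontier (U i)
  bd_closed : ∀ i j, 𝒢.Adj i j → IsClosed {x : U i | (x : Coord M) ∈ bd i j}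
  /-- the gluing maps -/
  φ : Fin N → Fin N → Coord M → Coord M
  φ_mapsTo : ∀ i j, 𝒢.Adj i j → Set.MapsTo (φ i j) (bd i j) (bd j i)
  φ_inverse : ∀ i j, 𝒢.Adj i j → ∀ x ∈ bd i j, φ j i (φ i j x) = x
  φ_differential : ∀ i j, 𝒢.Adj i j → ∀ x ∈ bd i j,
    HasFDerivWithinAt (φ i j)
      (Matrix.toEuclideanCLM (𝕜 := ℝ) (edgeTranslation (G i x) (G j (φ i j x)))) (bd i j) x

namespace GluingData

variable {N M : ℕ} {𝒢 : SimpleGraph (Fin N)} (D : GluingData 𝒢 M)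

/-- The edge tangent translation `P^(i,j)` at the point `x` of the gluing boundary, acting on
tangent vectors: `T_x U_i → T_{φ(x)} U_j`. -/
def P (i j : Fin N) (x : Coord M) : Coord M →L[ℝ] Coord M :=
  Matrix.toEuclideanCLM (𝕜 := ℝ) (edgeTranslation (D.G i x) (D.G j (D.φ i j x)))

/-- The disjoint union of the pieces. -/
abbrev Pieces : Type := Σ i, D.U i

/-- The identifications of points: `x ∈ ∂U_i` is identified with `φ(x) ∈ ∂U_j`. -/
inductive PointRel : D.Pieces → D.Pieces → Prop
  | edge {i j : Fin N} (x : D.U i) (y : D.U j) (hij : 𝒢.Adj i j)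
      (hx : (x : Coord M) ∈ D.bd i j) (hy : (y : Coord M) = D.φ i j x) :
      PointRel ⟨i, x⟩ ⟨j, y⟩

/-- The glued space `⋃_φ U_i`, with the quotient topology: the quotient of the disjoint union
of the pieces by the equivalence relation generated by the identifications. -/
abbrev Space : Type := Quot D.PointRel

/-- The disjoint union of the bundles `TU_i ⊕ TU_i` of pairs of tangent vectors with a common
base point. -/
abbrev PiecePairs : Type := Σ i, D.U i × (Coord M × Coord M)

/-- The identifications of pairs of tangent vectors: a pair `(u, v)` at `x ∈ ∂U_i` is identified
with the pair `(P u, P v)` at `φ(x) ∈ ∂U_j`. -/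
inductive PairRel : D.PiecePairs → D.PiecePairs → Prop
  | edge {i j : Fin N} (x : D.U i) (y : D.U j) (hij : 𝒢.Adj i j)
      (hx : (x : Coord M) ∈ D.bd i j) (hy : (y : Coord M) = D.φ i j x) (u v : Coord M) :
      PairRel ⟨i, x, u, v⟩ ⟨j, y, D.P i j x u, D.P i j x v⟩

/-- The bundle of pairs of tangent vectors of the glued space, with the quotient topology: the
bundles `TU_i ⊕ TU_i`, glued along the differentials of the gluing maps.  No triviality of the
holonomy is needed for this: a pair is transported by applying the same map to both vectors. -/
abbrev TangentPairs : Type := Quot D.PairRel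

/-- The projection of the bundle of pairs of tangent vectors onto the glued space. -/
def proj : D.TangentPairs → D.Space :=
  Quot.lift (fun w => Quot.mk _ ⟨w.1, w.2.1⟩) (by
    rintro _ _ ⟨x, y, hij, hx, hy, u, v⟩
    exact Quot.sound (PointRel.edge x y hij hx hy))

/-- The pairs of tangent vectors of the glued space at the point `p`. -/
abbrev TangentPairsAt (p : D.Space) : Type := {w : D.TangentPairs // D.proj w = p}

/-- The canonical map `U_i → ⋃_φ U_i`. -/
def incl (i : Fin N) (x : D.U i) : D.Space := Quot.mk _ ⟨i, x⟩

/-- The map that the canonical map `U_i → ⋃_φ U_i` induces on pairs of tangent vectors. -/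
def inclPair (i : Fin N) (x : D.U i) (u v : Coord M) : D.TangentPairsAt (D.incl i x) :=
  ⟨Quot.mk _ ⟨i, x, u, v⟩, rfl⟩

/-- The restriction (pullback) to the piece `U_i` of a field of functions of two tangent vectors
on the glued space. -/
def restrict (g : (p : D.Space) → D.TangentPairsAt p → ℝ) (i : Fin N) (x : D.U i)
    (u v : Coord M) : ℝ :=
  g (D.incl i x) (D.inclPair i x u v)

/-- A continuous Riemannian metric on the glued space: it assigns to each point `p` of the glued
space a function of two tangent vectors at `p`, which is a symmetric positive definite bilinear
form on the tangent space `T_x U_i` for each representative `x ∈ U_i` of `p`, and which depends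
continuously on `p` and the two tangent vectors. -/
@[ext]
structure GlobalMetric where
  val : (p : D.Space) → D.TangentPairsAt p → ℝ
  symm : ∀ i x u v, D.restrict val i x u v = D.restrict val i x v u
  add_left : ∀ i x u u' v,
    D.restrict val i x (u + u') v = D.restrict val i x u v + D.restrict val i x u' v
  smul_left : ∀ i x (c : ℝ) u v, D.restrict val i x (c • u) v = c * D.restrict val i x u v
  pos : ∀ i x u, u ≠ 0 → 0 < D.restrict val i x u u
  continuous : Continuous fun w : D.TangentPairs => val (D.proj w) ⟨w, rfl⟩

end GluingData

end NeuralGluing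

end

open scoped Matrix

namespace NeuralGluing

variable {M : ℕ}

/-! Everything rests on one identity: the edge translation is an isometry. With `S = Gj^{1/2}`, `Q =
(S Gi S)^{1/2}` and `P = S⁻¹ Q S⁻¹`, symmetry of `P` gives `Pᵀ Gj P = S⁻¹ Q² S⁻¹ = Gi`. Hence the
local metrics agree on identified pairs of tangent vectors and descend to the quotient bundle, where
the quotient topology makes the result continuous. Uniqueness holds because every pair in the
quotient is represented in some piece. -/

theorem msqrt_mul_self {A : Matrix (Fin M) (Fin M) ℝ} (hA : A.PosSemidef) :
    msqrt A * msqrt A = A := by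
  have hs : IsSelfAdjoint A := hA.isHermitian
  unfold msqrt
  rw [← cfc_mul Real.sqrt Real.sqrt A]
  conv_rhs => rw [← cfc_id ℝ A]
  -- `√t * √t = t` is needed only on the spectrum, where `t ≥ 0`.
  refine cfc_congr fun t ht => ?_
  have ht0 : 0 ≤ t := by
    rw [hA.isHermitian.spectrum_real_eq_range_eigenvalues] at ht
    obtain ⟨k, rfl⟩ := ht
    exact hA.eigenvalues_nonneg k
  exact Real.mul_self_sqrt ht0

/-- The real functional calculus always returns a self-adjoint element, with default value `0` when
`A` is not symmetric. -/
theorem msqrt_transpose (A : Matrix (Fin M) (Fin M) ℝ) : (msqrt A)ᵀ = msqrt A := by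
  have h : IsSelfAdjoint (msqrt A) := cfc_predicate Real.sqrt A
  rw [← Matrix.conjTranspose_eq_transpose_of_trivial]
  exact h

theorem isUnit_det_msqrt {A : Matrix (Fin M) (Fin M) ℝ} (hA : A.PosDef) :
    IsUnit (msqrt A).det := by
  have h := congrArg Matrix.det (msqrt_mul_self hA.posSemidef)
  rw [Matrix.det_mul] at h
  exact isUnit_of_mul_isUnit_left (h ▸ hA.det_pos.ne'.isUnit)

/-- The edge translation is an isometry from the metric `Gi` to the metric `Gj`. -/
theorem edgeTranslation_transpose_mul_mul {Gi Gj : Matrix (Fin M) (Fin M) ℝ}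
    (hi : Gi.PosDef) (hj : Gj.PosDef) :
    (edgeTranslation Gi Gj)ᵀ * Gj * edgeTranslation Gi Gj = Gi := by
  have hS := isUnit_det_msqrt hj
  have hSS := msqrt_mul_self hj.posSemidef
  have hQ : (msqrt Gj * Gi * msqrt Gj).PosSemidef := by
    have h := hi.posSemidef.conjTranspose_mul_mul_same (msqrt Gj)
    rwa [Matrix.conjTranspose_eq_transpose_of_trivial, msqrt_transpose] at h
  have hQQ := msqrt_mul_self hQ
  have hT : (edgeTranslation Gi Gj)ᵀ = edgeTranslation Gi Gj := by
    simp only [edgeTranslation, Matrix.transpose_mul, Matrix.transpose_nonsing_inv,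
      msqrt_transpose, Matrix.mul_assoc]
  rw [hT, edgeTranslation]
  -- From here only `S * S = Gj`, `Q * Q = S * Gi * S` and the invertibility of `S` matter.
  generalize msqrt (msqrt Gj * Gi * msqrt Gj) = Q at hQQ
  generalize msqrt Gj = S at hS hSS hQQ
  calc S⁻¹ * Q * S⁻¹ * Gj * (S⁻¹ * Q * S⁻¹)
      = S⁻¹ * Q * (S⁻¹ * S) * (S * S⁻¹) * Q * S⁻¹ := by
        rw [← hSS]; simp only [Matrix.mul_assoc]
    _ = S⁻¹ * (Q * Q) * S⁻¹ := by
        rw [Matrix.nonsing_inv_mul S hS, Matrix.mul_nonsing_inv S hS]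
        simp only [Matrix.mul_assoc, Matrix.one_mul]
    _ = (S⁻¹ * S) * Gi * (S * S⁻¹) := by rw [hQQ]; simp only [Matrix.mul_assoc]
    _ = Gi := by
        rw [Matrix.nonsing_inv_mul S hS, Matrix.mul_nonsing_inv S hS, Matrix.one_mul,
          Matrix.mul_one]

theorem form_toEuclideanCLM (A B : Matrix (Fin M) (Fin M) ℝ) (u v : Coord M) :
    form A (Matrix.toEuclideanCLM (𝕜 := ℝ) B u) (Matrix.toEuclideanCLM (𝕜 := ℝ) B v) =
      form (Bᵀ * A * B) u v := by
  simp only [form, Matrix.ofLp_toEuclideanCLM, Matrix.mulVec_mulVec, Matrix.mul_assoc]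
  rw [← Matrix.mulVec_mulVec (M := Bᵀ), Matrix.dotProduct_mulVec u.ofLp Bᵀ,
    Matrix.vecMul_transpose]

theorem form_comm {A : Matrix (Fin M) (Fin M) ℝ} (hA : A.IsHermitian) (u v : Coord M) :
    form A u v = form A v u := by
  have hT : Aᵀ = A := by
    rw [← Matrix.conjTranspose_eq_transpose_of_trivial]; exact hA
  unfold form
  rw [Matrix.dotProduct_mulVec, ← Matrix.mulVec_transpose, hT, dotProduct_comm]

theorem form_self_pos {A : Matrix (Fin M) (Fin M) ℝ} (hA : A.PosDef) {u : Coord M}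
    (hu : u ≠ 0) : 0 < form A u u := by
  have hu' : u.ofLp ≠ 0 := fun h => hu (by ext k; exact congrFun h k)
  simpa [form] using hA.dotProduct_mulVec_pos hu'

theorem continuous_form {X : Type*} [TopologicalSpace X] {A : X → Matrix (Fin M) (Fin M) ℝ}
    {u v : X → Coord M} (hA : Continuous A) (hu : Continuous u) (hv : Continuous v) :
    Continuous fun x => form (A x) (u x) (v x) :=
  Continuous.dotProduct ((PiLp.continuous_ofLp 2 _).comp hu)
    (Continuous.matrix_mulVec hA ((PiLp.continuous_ofLp 2 _).comp hv))

namespace GluingData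

variable {N : ℕ} {𝒢 : SimpleGraph (Fin N)} (D : GluingData 𝒢 M)

/-- The local metrics, as a function on the bundle of pairs of tangent vectors. -/
def glueForm : D.TangentPairs → ℝ :=
  Quot.lift (fun w => form (D.G w.1 w.2.1) w.2.2.1 w.2.2.2) (by
    rintro _ _ ⟨x, y, hij, hx, hy, u, v⟩
    dsimp only
    -- Invariance under the generating identifications suffices; on an edge it is the isometry
    -- identity.
    rw [P, form_toEuclideanCLM, ← hy, edgeTranslation_transpose_mul_mul
      (D.G_posDef _ _ x.2) (D.G_posDef _ _ y.2)])

theorem continuous_glueForm : Continuous D.glueForm := by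
  refine continuous_quot_lift _ (continuous_sigma fun i => ?_)
  have hG : Continuous fun x : D.U i => D.G i x :=
    continuousOn_iff_continuous_domRestrict.1 (D.G_continuousOn i)
  have hG' : Continuous fun w : D.U i × (Coord M × Coord M) => D.G i w.1 :=
    hG.comp continuous_fst
  exact continuous_form hG' (continuous_fst.comp continuous_snd)
    (continuous_snd.comp continuous_snd)

/-- The global metric obtained by gluing the local metrics. -/
def glueMetric : D.GlobalMetric where
  val _ w := D.glueForm w.1
  -- Restricting to a piece unfolds definitionally to `form (D.G i x)`, so the axioms are pointwise
  -- matrix facts.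
  symm i x u v := form_comm (D.G_posDef i x x.2).isHermitian u v
  add_left _ _ u u' _ := add_dotProduct u.ofLp u'.ofLp _
  smul_left _ _ c u _ := smul_dotProduct c u.ofLp _
  pos i x _ hu := form_self_pos (D.G_posDef i x x.2) hu
  continuous := D.continuous_glueForm

/-- A global metric is determined by its restrictions to the pieces. -/
theorem GlobalMetric.ext_restrict {D : GluingData 𝒢 M} {g h : D.GlobalMetric}
    (H : ∀ i x u v, D.restrict g.val i x u v = D.restrict h.val i x u v) : g = h := by
  refine GlobalMetric.ext ?_
  funext p ⟨w, hw⟩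
  -- The base point becomes `D.proj w`, which leaves `w` free for quotient induction.
  subst hw
  induction w using Quot.ind with
  | mk w => exact H w.1 w.2.1 w.2.2.1 w.2.2.2

end GluingData

end NeuralGluing

theorem theorem4p6 {N M : ℕ} (𝒢 : SimpleGraph (Fin N)) (D : NeuralGluing.GluingData 𝒢 M) :
    ∃! g : D.GlobalMetric, ∀ (i : Fin N) (x : D.U i) (u v : NeuralGluing.Coord M),
      D.restrict g.val i x u v = NeuralGluing.form (D.G i x) u v :=
  ⟨D.glueMetric, fun _ _ _ _ => rfl, fun _ hg =>
    NeuralGluing.GluingData.GlobalMetric.ext_restrict hg⟩
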